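/- Let $H$ be a complex Hilbert space, $L(H)$ the algebra of bounded operators on $H$ with the operator norm, and write $R(T)$, $N(T)$ for the range and null space of $T\in L(H)$. An operator $A\in L(H)$ is core invertible if there is $X\in L(H)$ with $AXA=A$, $X\,L(H)=A\,L(H)$, $L(H)\,X=L(H)\,A^*$, and dual core invertible if there is $X\in L(H)$ with $AXA=A$, $X\,L(H)=A^*L(H)$, $L(H)\,X=L(H)\,A$; such an $X$ is unique and is written $A^{\mathrm{c}}$, the core inverse, respectively $A^{\mathrm{d}}$, the dual core inverse. For closed subspaces $M,N$ of $H$ let $\delta(M,N)=\sup\{\operatorname{dist}(x,N): x\in M,\ \|x\|=1\}$ (and $\delta(0,N)=0$), and let $\operatorname{gap}(M,N)=\max\{\delta(M,N),\delta(N,M)\}$. Let $A\in L(H)$, $A\neq 0$, and let $(A_n)_{n\in\mathbb N}\subset L(H)$ be a sequence converging to $A$, such that $A$ and every $A_n$ is core invertible or dual core invertible. Then $A$ and every $A_n$ is both core invertible and dual core invertible, and the following statements are equivalent (convergence of operators is in norm): 1. $A_n^{\mathrm{c}}\to A^{\mathrm{c}}$. 2. $A_n^{\mathrm{d}}\to A^{\mathrm{d}}$.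 3. $A_n^{\mathrm{c}}A_n\to A^{\mathrm{c}}A$. 4. $A_nA_n^{\mathrm{d}}\to A^{\mathrm{c}}A$. 5. $\operatorname{gap}(R(A_n^{\mathrm{c}}),R(A^{\mathrm{c}}))\to 0$. 6. $\operatorname{gap}(R(A_n),R(A))\to 0$. 7. $\operatorname{gap}(N(A_n^{\mathrm{c}}),N(A^{\mathrm{c}}))\to 0$. 8. $\operatorname{gap}(N(A_n^*),N(A^*))\to 0$. 9. $\operatorname{gap}(R(A_n^{\mathrm{d}}),R(A^{\mathrm{d}}))\to 0$. 10. $\operatorname{gap}(R(A_n^*),R(A^*))\to 0$. 11. $\operatorname{gap}(N(A_n^{\mathrm{d}}),N(A^{\mathrm{d}}))\to 0$. 12. $\operatorname{gap}(N(A_n),N(A))\to 0$. -/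

import Mathlib

open Filter Topology

section CoreInverse

variable {R : Type*} [Ring R] [StarRing R]

/-- `x` is a core inverse of `a`: `axa = a`, `xR = aR` and `Rx = Ra*`. -/
structure IsCoreInverse (a x : R) : Prop where
  inner : a * x * a = a
  right_ideal : (Set.range fun z : R => x * z) = Set.range fun z : R => a * z
  left_ideal : (Set.range fun z : R => z * x) = Set.range fun z : R => z * star a

/-- `x` is a dual core inverse of `a`: `axa = a`, `xR = a*R` and `Rx = Ra`. -/
structure IsDualCoreInverse (a x : R) : Prop where
  inner : a * x * a = a
  right_ideal : (Set.range fun z : R => x * z) = Set.range fun z : R => star a * z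
  left_ideal : (Set.range fun z : R => z * x) = Set.range fun z : R => z * a

/-- `a` is core invertible. -/
def CoreInvertible (a : R) : Prop := ∃ x, IsCoreInverse a x

/-- `a` is dual core invertible. -/
def DualCoreInvertible (a : R) : Prop := ∃ x, IsDualCoreInverse a x

theorem IsCoreInverse.unique {a x y : R} (hx : IsCoreInverse a x) (hy : IsCoreInverse a y) :
    x = y := by
  have key : ∀ w : R, IsCoreInverse a w →
      star (a * w) = a * w ∧ w * (a * w) = w ∧ w * a * a = a ∧ ∃ r, w = a * r := by
    intro w hw
    obtain ⟨u, hu⟩ : w ∈ Set.range fun z : R => z * star a := hw.left_ideal ▸ ⟨1, one_mul w⟩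
    obtain ⟨r, hr⟩ : w ∈ Set.range fun z : R => a * z := hw.right_ideal ▸ ⟨1, mul_one w⟩
    obtain ⟨t, ht⟩ : a ∈ Set.range fun z : R => w * z := hw.right_ideal.symm ▸ ⟨1, mul_one a⟩
    simp only at hu hr ht
    have h1 : w * star (a * w) = w := by
      calc w * star (a * w) = u * star (a * w * a) := by
            rw [star_mul (a * w) a, ← mul_assoc, hu]
        _ = w := by rw [hw.inner, hu]
    have h2 : star (a * w) = a * w := by
      have h3 : a * w * star (a * w) = a * w := by rw [mul_assoc, h1]
      have h4 := congrArg star h3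
      rw [star_mul, star_star, h3] at h4
      exact h4.symm
    have h5 : w * (a * w) = w := by rw [h2] at h1; exact h1
    refine ⟨h2, h5, ?_, r, hr.symm⟩
    calc w * a * a = w * (a * w) * t := by rw [mul_assoc (w) (a * w) t, mul_assoc a w t, ht,
          mul_assoc]
      _ = a := by rw [h5, ht]
  obtain ⟨sx, ox, cx, -⟩ := key x hx
  obtain ⟨sy, -, -, r, hr⟩ := key y hy
  have e1 : a * x * (a * y) = a * y := by rw [← mul_assoc, hx.inner]
  have e2 : a * y * (a * x) = a * x := by rw [← mul_assoc, hy.inner]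
  have e3 : a * x = a * y := by
    have := congrArg star e1
    rw [star_mul, sx, sy, e2] at this
    exact this
  calc x = x * (a * y) := by rw [← e3, ox]
    _ = x * a * a * r := by rw [hr]; simp only [mul_assoc]
    _ = y := by rw [cx, ← hr]

theorem isDualCoreInverse_iff_star {a x : R} :
    IsDualCoreInverse a x ↔ IsCoreInverse (star a) (star x) := by
  have left : ∀ b c : R, ((Set.range fun z : R => b * z) = Set.range fun z : R => c * z) →
      (Set.range fun z : R => z * star b) = Set.range fun z : R => z * star c := by
    intro b c h
    ext w
    have := Set.ext_iff.1 h (star w)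
    simp only [Set.mem_range] at this ⊢
    constructor
    · rintro ⟨z, rfl⟩
      obtain ⟨z', hz'⟩ := this.1 ⟨star z, by simp⟩
      exact ⟨star z', by rw [← star_mul, hz', star_star]⟩
    · rintro ⟨z, rfl⟩
      obtain ⟨z', hz'⟩ := this.2 ⟨star z, by simp⟩
      exact ⟨star z', by rw [← star_mul, hz', star_star]⟩
  have right : ∀ b c : R, ((Set.range fun z : R => z * b) = Set.range fun z : R => z * c) →
      (Set.range fun z : R => star b * z) = Set.range fun z : R => star c * z := by
    intro b c h
    ext w
    have := Set.ext_iff.1 h (star w)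
    simp only [Set.mem_range] at this ⊢
    constructor
    · rintro ⟨z, rfl⟩
      obtain ⟨z', hz'⟩ := this.1 ⟨star z, by simp⟩
      exact ⟨star z', by rw [← star_mul, hz', star_star]⟩
    · rintro ⟨z, rfl⟩
      obtain ⟨z', hz'⟩ := this.2 ⟨star z, by simp⟩
      exact ⟨star z', by rw [← star_mul, hz', star_star]⟩
  constructor
  · intro h
    exact ⟨by rw [← star_mul, ← star_mul, ← mul_assoc, h.inner], right _ _ h.left_ideal,
      left _ _ h.right_ideal⟩
  · intro h
    refine ⟨?_, ?_, ?_⟩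
    · have := congrArg star h.inner
      simpa [mul_assoc] using this
    · simpa using right _ _ h.left_ideal
    · simpa using left _ _ h.right_ideal

theorem IsDualCoreInverse.unique {a x y : R} (hx : IsDualCoreInverse a x)
    (hy : IsDualCoreInverse a y) : x = y :=
  star_injective ((isDualCoreInverse_iff_star.1 hx).unique (isDualCoreInverse_iff_star.1 hy))

open Classical in
/-- The core inverse of `a` (with value `0` if `a` is not core invertible). -/
noncomputable def coreInverse (a : R) : R :=
  if h : CoreInvertible a then h.choose else 0

open Classical in
/-- The dual core inverse of `a` (with value `0` if `a` is not dual core invertible). -/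
noncomputable def dualCoreInverse (a : R) : R :=
  if h : DualCoreInvertible a then h.choose else 0

theorem CoreInvertible.isCoreInverse {a : R} (h : CoreInvertible a) :
    IsCoreInverse a (coreInverse a) := by
  rw [coreInverse, dif_pos h]
  exact h.choose_spec

theorem DualCoreInvertible.isDualCoreInverse {a : R} (h : DualCoreInvertible a) :
    IsDualCoreInverse a (dualCoreInverse a) := by
  rw [dualCoreInverse, dif_pos h]
  exact h.choose_spec

end CoreInverse

section Gap

variable {E : Type*} [NormedAddCommGroup E] [NormedSpace ℂ E]

/-- `δ(M, N) = sup {dist(x, N) : x ∈ M, ‖x‖ = 1}`. If `M = 0` the set is empty and the supremum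
is `0`; in general the set is bounded above by `1`. -/
noncomputable def gapDelta (M N : Submodule ℂ E) : ℝ :=
  sSup {d : ℝ | ∃ x ∈ M, ‖x‖ = 1 ∧ d = Metric.infDist x (N : Set E)}

/-- The gap between two subspaces. -/
noncomputable def gap (M N : Submodule ℂ E) : ℝ :=
  max (gapDelta M N) (gapDelta N M)

end Gap

/-! ### Algebraic identities for core and dual core inverses. -/

section Algebra

variable {R : Type*} [Ring R] [StarRing R] {a x y : R}

/-! If `x` is a core inverse of `a`, then `p = a * x` is the orthogonal projection onto the range of
`a`, and `x * a` is the oblique idempotent with the range and kernel of `a`. Moreover `x = (a * p +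
(1 - p))⁻¹ * p`, so `x` depends continuously on `a` and `p` (`IsCoreInverse.tendsto_iff`). For
orthogonal projections, norm convergence is gap convergence of ranges, or of kernels; hence core
inverses converge iff the ranges of `An` do. Taking adjoints, dual core inverses converge iff the
kernels of `An` do.

The two halves meet in the oblique idempotent, which is also `a * y` for the dual core inverse `y`:
convergence of either inverse makes it converge, and its convergence forces that of both its range
and its kernel (`tendsto_gap_range`). -/

theorem IsCoreInverse.exists_left_factor (h : IsCoreInverse a x) : ∃ u, u * star a = x :=
  h.left_ideal.subset ⟨1, one_mul x⟩

theorem IsCoreInverse.exists_left_factor_star (h : IsCoreInverse a x) : ∃ u, u * x = star a :=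
  h.left_ideal.superset ⟨1, one_mul _⟩

theorem IsCoreInverse.exists_right_factor (h : IsCoreInverse a x) : ∃ r, a * r = x :=
  h.right_ideal.subset ⟨1, mul_one x⟩

theorem IsCoreInverse.exists_right_factor_self (h : IsCoreInverse a x) : ∃ t, x * t = a :=
  h.right_ideal.superset ⟨1, mul_one _⟩

theorem IsCoreInverse.mul_star_mul (h : IsCoreInverse a x) : x * star (a * x) = x := by
  obtain ⟨u, hu⟩ := h.exists_left_factor
  calc x * star (a * x) = u * star (a * x * a) := by rw [star_mul (a * x) a, ← mul_assoc, hu]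
    _ = x := by rw [h.inner, hu]

theorem IsCoreInverse.isStarProjection (h : IsCoreInverse a x) : IsStarProjection (a * x) where
  isIdempotentElem := by rw [IsIdempotentElem, ← mul_assoc, h.inner]
  isSelfAdjoint := by
    have h1 : a * x * star (a * x) = a * x := by rw [mul_assoc, h.mul_star_mul]
    have h2 := congrArg star h1
    rw [star_mul, star_star, h1] at h2
    exact h2.symm

theorem IsCoreInverse.outer (h : IsCoreInverse a x) : x * a * x = x := by
  have := h.mul_star_mul
  rwa [h.isStarProjection.isSelfAdjoint.star_eq, ← mul_assoc] at this

theorem IsCoreInverse.mul_mul_self (h : IsCoreInverse a x) : x * a * a = a := by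
  obtain ⟨t, ht⟩ := h.exists_right_factor_self
  calc x * a * a = x * a * x * t := by rw [mul_assoc _ x t, ht]
    _ = a := by rw [h.outer, ht]

theorem IsCoreInverse.self_mul_mul (h : IsCoreInverse a x) : a * x * x = x := by
  obtain ⟨r, hr⟩ := h.exists_right_factor
  calc a * x * x = a * x * a * r := by rw [mul_assoc _ a r, hr]
    _ = x := by rw [h.inner, hr]

theorem IsDualCoreInverse.isCoreInverse_star (h : IsDualCoreInverse a x) : IsCoreInverse (star a) (star x) :=
  isDualCoreInverse_iff_star.1 h

theorem IsDualCoreInverse.isStarProjection (h : IsDualCoreInverse a x) :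
    IsStarProjection (x * a) := by
  have h1 := h.isCoreInverse_star.isStarProjection
  rw [← star_mul] at h1
  have h2 := h1.isSelfAdjoint.star_eq
  rw [star_star] at h2
  rwa [← h2] at h1

/-- Both products are the idempotent attached to the group inverse of `a`. -/
theorem IsCoreInverse.mul_eq_mul_dual (hx : IsCoreInverse a x) (hy : IsDualCoreInverse a y) :
    x * a = a * y := by
  obtain ⟨u, hu⟩ : ∃ u, u * a = y := hy.left_ideal.subset ⟨1, one_mul y⟩
  obtain ⟨v, hv⟩ : ∃ v, v * y = a := hy.left_ideal.superset ⟨1, one_mul a⟩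
  have h1 : a * a * y = a := by
    have := congrArg Star.star hy.isCoreInverse_star.mul_mul_self
    simpa [mul_assoc] using this
  calc x * a = x * (a * a * y) := by rw [h1]
    _ = x * a * a * y := by simp only [mul_assoc]
    _ = a * y := by rw [hx.mul_mul_self]

/-- A core inverse `x` of `a` and a self-adjoint idempotent `p` with the same right annihilator as
`x * a` give a dual core inverse. -/
theorem IsCoreInverse.isDualCoreInverse {p : R} (h : IsCoreInverse a x) (hp : star p = p)
    -- Here `x * x * a` is the group inverse of `a`; the witness is `p` times it.
    (hap : a * p = a) (hpg : p * (x * a) = p) : IsDualCoreInverse a (p * x * x * a) := by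
  have haxx : a * (x * x * a) = x * a := by
    rw [← mul_assoc, ← mul_assoc, h.self_mul_mul]
  have hpa : star a = p * star a := by
    have := congrArg star hap
    rw [star_mul, hp] at this
    exact this.symm
  have hpa' : p = star a * star x * p := by
    have := congrArg star hpg
    rw [star_mul, star_mul, hp] at this
    exact this.symm
  have hay : a * (p * x * x * a) = x * a := by
    calc a * (p * x * x * a) = a * p * (x * x * a) := by simp only [mul_assoc]
      _ = x * a := by rw [hap, haxx]
  have hya : p * x * x * a * a = p := by
    calc p * x * x * a * a = p * (x * (x * a * a)) := by simp only [mul_assoc]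
      _ = p := by rw [h.mul_mul_self, hpg]
  refine ⟨by rw [hay, h.mul_mul_self], ?_, ?_⟩
  · ext w
    constructor
    · rintro ⟨z, rfl⟩
      refine ⟨star x * p * x * x * a * z, ?_⟩
      calc star a * (star x * p * x * x * a * z) = star a * star x * p * x * x * a * z := by
            simp only [mul_assoc]
        _ = _ := by rw [← hpa']
    · rintro ⟨z, rfl⟩
      refine ⟨a * star a * z, ?_⟩
      calc p * x * x * a * (a * star a * z) = p * x * x * a * a * star a * z := by
            simp only [mul_assoc]
        _ = _ := by rw [hya, ← hpa]
  · ext w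
    constructor
    · rintro ⟨z, rfl⟩
      exact ⟨z * (p * x * x), by simp only [mul_assoc]⟩
    · rintro ⟨z, rfl⟩
      refine ⟨z * a * a, ?_⟩
      calc z * a * a * (p * x * x * a) = z * a * (a * (p * x * x * a)) := by simp only [mul_assoc]
        _ = z * (a * x * a) := by rw [hay]; simp only [mul_assoc]
        _ = z * a := by rw [h.inner]

/-- The unit acting as `a` on the range of `a * x` and as the identity on its complement. -/
def IsCoreInverse.unit (h : IsCoreInverse a x) : Rˣ where
  val := a * (a * x) + (1 - a * x)
  inv := x + (1 - a * x)
  val_inv := by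
    have h1 := h.isStarProjection.isIdempotentElem.eq
    have h2 := h.self_mul_mul
    calc (a * (a * x) + (1 - a * x)) * (x + (1 - a * x))
        = a * (a * x * x) + (a * (a * x) - a * (a * x * (a * x))) + (x - a * x * x)
          + (1 - a * x) - (a * x - a * x * (a * x)) := by noncomm_ring
      _ = 1 := by rw [h1, h2]; abel
  inv_val := by
    have h1 := h.isStarProjection.isIdempotentElem.eq
    have h2 := h.outer
    have h3 := h.mul_mul_self
    have h4 := h.inner
    calc (x + (1 - a * x)) * (a * (a * x) + (1 - a * x))
        = x * a * a * x + (x - x * a * x) + (a - a * x * a) * (a * x)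
          + (1 - a * x) - (a * x - a * x * (a * x)) := by noncomm_ring
      _ = 1 := by rw [h1, h2, h3, h4]; simp

theorem IsCoreInverse.unit_inv_mul (h : IsCoreInverse a x) :
    Ring.inverse (a * (a * x) + (1 - a * x)) * (a * x) = x := by
  have h1 : Ring.inverse (a * (a * x) + (1 - a * x)) = x + (1 - a * x) :=
    Ring.inverse_unit h.unit
  rw [h1, add_mul, sub_mul, one_mul, h.isStarProjection.isIdempotentElem.eq, sub_self, add_zero,
    ← mul_assoc, h.outer]

end Algebra

/-- Inversion is continuous at a unit of a complete normed ring, so the formula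
`IsCoreInverse.unit_inv_mul`, valid for every `b i`, passes to the limit. -/
theorem IsCoreInverse.tendsto_iff {R ι : Type*} [NormedRing R] [CompleteSpace R] [StarRing R]
    {l : Filter ι} {a x : R} {b y : ι → R} (h : IsCoreInverse a x)
    (hb : ∀ i, IsCoreInverse (b i) (y i)) (hlim : Tendsto b l (𝓝 a)) :
    Tendsto y l (𝓝 x) ↔ Tendsto (fun i => b i * y i) l (𝓝 (a * x)) := by
  refine ⟨fun hy => hlim.mul hy, fun hq => ?_⟩
  have h1 := (NormedRing.inverse_continuousAt h.unit).tendsto.comp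
    ((hlim.mul hq).add (hq.const_sub 1))
  have h2 := h1.mul hq
  have h3 : Ring.inverse (h.unit : R) * (a * x) = x := h.unit_inv_mul
  rw [h3] at h2
  exact h2.congr fun i => (hb i).unit_inv_mul

/-! ### The gap between ranges of idempotents. -/

section Gap

variable {E : Type*} [NormedAddCommGroup E] [NormedSpace ℂ E]

theorem gapDelta_bddAbove (M N : Submodule ℂ E) :
    BddAbove {d : ℝ | ∃ x ∈ M, ‖x‖ = 1 ∧ d = Metric.infDist x (N : Set E)} := by
  refine ⟨1, ?_⟩
  rintro _ ⟨x, -, hx, rfl⟩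
  simpa [hx] using Metric.infDist_le_dist_of_mem (x := x) N.zero_mem

theorem gapDelta_nonneg (M N : Submodule ℂ E) : 0 ≤ gapDelta M N :=
  Real.sSup_nonneg fun d hd => by
    obtain ⟨x, -, -, rfl⟩ := hd
    exact Metric.infDist_nonneg

theorem gap_nonneg (M N : Submodule ℂ E) : 0 ≤ gap M N :=
  (gapDelta_nonneg M N).trans (le_max_left _ _)

theorem infDist_le_gapDelta {M N : Submodule ℂ E} {x : E} (hx : x ∈ M) (h1 : ‖x‖ = 1) :
    Metric.infDist x (N : Set E) ≤ gapDelta M N :=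
  le_csSup (gapDelta_bddAbove M N) ⟨x, hx, h1, rfl⟩

/-- A unit vector `x = e x` lies within `‖(e - f) x‖` of `f x`. Orthogonality plays no role, so this
covers oblique idempotents. -/
theorem gapDelta_range_le {e f : E →L[ℂ] E} (he : IsIdempotentElem e) :
    gapDelta e.range f.range ≤ ‖e - f‖ := by
  refine Real.sSup_le ?_ (norm_nonneg _)
  rintro _ ⟨_, ⟨z, rfl⟩, hx, rfl⟩
  have hez : e (e z) = e z := congrArg (fun T : E →L[ℂ] E => T z) he.eq
  change ‖e z‖ = 1 at hx
  change Metric.infDist (e z) _ ≤ _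
  refine (Metric.infDist_le_dist_of_mem (y := f (e z))
    (show f (e z) ∈ f.range from ⟨e z, rfl⟩)).trans ?_
  calc dist (e z) (f (e z)) = ‖(e - f) (e z)‖ := by
        rw [sub_apply, hez, dist_eq_norm]
    _ ≤ ‖e - f‖ * ‖e z‖ := (e - f).le_opNorm _
    _ = ‖e - f‖ := by rw [hx, mul_one]

theorem gap_range_le {e f : E →L[ℂ] E} (he : IsIdempotentElem e) (hf : IsIdempotentElem f) :
    gap e.range f.range ≤ ‖e - f‖ :=
  max_le (gapDelta_range_le he) (norm_sub_rev e f ▸ gapDelta_range_le hf)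

theorem tendsto_gap_range {ι : Type*} {l : Filter ι} {e : E →L[ℂ] E} {f : ι → E →L[ℂ] E}
    (he : IsIdempotentElem e) (hf : ∀ i, IsIdempotentElem (f i)) (h : Tendsto f l (𝓝 e)) :
    Tendsto (fun i => gap (f i).range e.range) l (𝓝 0) :=
  squeeze_zero (fun _ => gap_nonneg _ _) (fun i => gap_range_le (hf i) he)
    (tendsto_iff_norm_sub_tendsto_zero.1 h)

theorem range_eq_of_mul {a b u v : E →L[ℂ] E} (h : b * u = a) (h' : a * v = b) :
    a.range = b.range := by
  apply le_antisymm
  · rintro _ ⟨z, rfl⟩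
    exact ⟨u z, congrArg (fun T : E →L[ℂ] E => T z) h⟩
  · rintro _ ⟨z, rfl⟩
    exact ⟨v z, congrArg (fun T : E →L[ℂ] E => T z) h'⟩

theorem ker_eq_of_mul {a b u v : E →L[ℂ] E} (h : u * b = a) (h' : v * a = b) :
    a.ker = b.ker := by
  have key : ∀ {c d w : E →L[ℂ] E}, w * d = c → ∀ z, d z = 0 → c z = 0 := by
    rintro c d w rfl z hz
    rw [mul_apply_eq_comp, hz, map_zero]
  ext z
  exact ⟨key h' z, key h z⟩

theorem ker_eq_range_one_sub {e : E →L[ℂ] E} (he : IsIdempotentElem e) :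
    e.ker = (1 - e).range := by
  ext z
  constructor
  · intro hz
    have hz : e z = 0 := hz
    exact ⟨z, by simp [hz]⟩
  · rintro ⟨w, rfl⟩
    have : e (e w) = e w := congrArg (fun T : E →L[ℂ] E => T w) he.eq
    simp [this]

end Gap

/-! ### Orthogonal projections, and core inverses of operators. -/

section Hilbert

variable {H : Type*} [NormedAddCommGroup H] [InnerProductSpace ℂ H] [CompleteSpace H]

theorem IsStarProjection.norm_le_one {R : Type*} [NormedRing R] [StarRing R] [CStarRing R]
    {e : R} (he : IsStarProjection e) : ‖e‖ ≤ 1 := by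
  have h := CStarRing.norm_star_mul_self (x := e)
  rw [he.isSelfAdjoint.star_eq, he.isIdempotentElem.eq] at h
  nlinarith [norm_nonneg e]

theorem IsStarProjection.norm_sub_apply_le_infDist {f : H →L[ℂ] H} (hf : IsStarProjection f)
    (x : H) : ‖x - f x‖ ≤ Metric.infDist x (f.range : Set H) := by
  refine (Metric.le_infDist ⟨0, f.range.zero_mem⟩).2 ?_
  rintro _ ⟨z, rfl⟩
  have h1 : f (f z) = f z := congrArg (fun T : H →L[ℂ] H => T z) hf.isIdempotentElem.eq
  calc ‖x - f x‖ = ‖(1 - f) (x - f z)‖ := by simp [h1]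
    _ ≤ ‖1 - f‖ * ‖x - f z‖ := (1 - f).le_opNorm _
    _ ≤ 1 * ‖x - f z‖ := by gcongr; exact hf.one_sub.norm_le_one
    _ = dist x (f z) := by rw [one_mul, dist_eq_norm]

/-- For an orthogonal projection `f`, `‖x - f x‖` is at most the distance from `x` to its range; the
bound on unit vectors extends by scaling, and `‖e‖ ≤ 1`. -/
theorem IsStarProjection.norm_one_sub_mul_le {e f : H →L[ℂ] H} (he : IsStarProjection e)
    (hf : IsStarProjection f) : ‖(1 - f) * e‖ ≤ gapDelta e.range f.range := by
  have hδ := gapDelta_nonneg e.range f.range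
  refine ContinuousLinearMap.opNorm_le_bound _ hδ fun z => ?_
  have key : ∀ x ∈ e.range, ‖(1 - f) x‖ ≤ gapDelta e.range f.range * ‖x‖ := by
    intro x hx
    rcases eq_or_ne x 0 with rfl | hx0
    · simp
    have hn : ‖x‖ ≠ 0 := norm_ne_zero_iff.2 hx0
    have h1 : ‖((‖x‖⁻¹ : ℝ) : ℂ) • x‖ = 1 := by
      rw [norm_smul, Complex.norm_real, norm_inv, norm_norm, inv_mul_cancel₀ hn]
    have h2 := (hf.norm_sub_apply_le_infDist _).trans
      (infDist_le_gapDelta (N := f.range) (e.range.smul_mem ((‖x‖⁻¹ : ℝ) : ℂ) hx) h1)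
    rw [map_smul, ← smul_sub, norm_smul, Complex.norm_real, norm_inv, norm_norm] at h2
    calc ‖(1 - f) x‖ = ‖x‖⁻¹ * ‖x - f x‖ * ‖x‖ := by
          rw [mul_comm, mul_inv_cancel_left₀ hn]; simp
      _ ≤ _ := by gcongr
  calc ‖((1 - f) * e) z‖ ≤ gapDelta e.range f.range * ‖e z‖ := key (e z) ⟨z, rfl⟩
    _ ≤ gapDelta e.range f.range * (1 * ‖z‖) := by
        gcongr
        exact e.le_of_opNorm_le he.norm_le_one z
    _ = _ := by rw [one_mul]

theorem IsStarProjection.norm_sub_le_gap {e f : H →L[ℂ] H} (he : IsStarProjection e)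
    (hf : IsStarProjection f) : ‖e - f‖ ≤ 2 * gap e.range f.range := by
  have h1 : ‖f * (1 - e)‖ = ‖(1 - e) * f‖ := by
    rw [← norm_star, star_mul, hf.isSelfAdjoint.star_eq, he.one_sub.isSelfAdjoint.star_eq]
  -- The second term is the adjoint of `(1 - e) * f`, so each of the two terms is bounded by one of
  -- the one-sided gaps.
  calc ‖e - f‖ = ‖(1 - f) * e - f * (1 - e)‖ := by congr 1; noncomm_ring
    _ ≤ ‖(1 - f) * e‖ + ‖f * (1 - e)‖ := norm_sub_le _ _
    _ ≤ gap e.range f.range + gap e.range f.range := by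
        rw [h1]
        exact add_le_add ((he.norm_one_sub_mul_le hf).trans (le_max_left _ _))
          ((hf.norm_one_sub_mul_le he).trans (le_max_right _ _))
    _ = _ := by ring

theorem IsStarProjection.tendsto_gap_range_iff {ι : Type*} {l : Filter ι} {e : H →L[ℂ] H}
    {f : ι → H →L[ℂ] H} (he : IsStarProjection e) (hf : ∀ i, IsStarProjection (f i)) :
    Tendsto (fun i => gap (f i).range e.range) l (𝓝 0) ↔ Tendsto f l (𝓝 e) := by
  refine ⟨fun h => ?_, tendsto_gap_range he.isIdempotentElem fun i => (hf i).isIdempotentElem⟩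
  rw [tendsto_iff_norm_sub_tendsto_zero]
  have h2 := h.const_mul 2
  rw [mul_zero] at h2
  exact squeeze_zero (fun _ => norm_nonneg _) (fun i => (hf i).norm_sub_le_gap he) h2

theorem IsStarProjection.tendsto_gap_ker_iff {ι : Type*} {l : Filter ι} {e : H →L[ℂ] H}
    {f : ι → H →L[ℂ] H} (he : IsStarProjection e) (hf : ∀ i, IsStarProjection (f i)) :
    Tendsto (fun i => gap (f i).ker e.ker) l (𝓝 0) ↔ Tendsto f l (𝓝 e) := by
  simp only [ker_eq_range_one_sub he.isIdempotentElem,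
    fun i => ker_eq_range_one_sub (hf i).isIdempotentElem]
  rw [he.one_sub.tendsto_gap_range_iff fun i => (hf i).one_sub]
  constructor
  · intro h
    simpa using h.const_sub 1
  · intro h
    exact h.const_sub 1

theorem IsCoreInverse.range_eq {A X : H →L[ℂ] H} (h : IsCoreInverse A X) : X.range = A.range := by
  obtain ⟨r, hr⟩ := h.exists_right_factor
  obtain ⟨t, ht⟩ := h.exists_right_factor_self
  exact range_eq_of_mul hr ht

theorem IsCoreInverse.ker_eq {A X : H →L[ℂ] H} (h : IsCoreInverse A X) :
    X.ker = (star A).ker := by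
  obtain ⟨r, hr⟩ := h.exists_left_factor
  obtain ⟨t, ht⟩ := h.exists_left_factor_star
  exact ker_eq_of_mul hr ht

theorem IsCoreInverse.range_mul {A X : H →L[ℂ] H} (h : IsCoreInverse A X) :
    A.range = (A * X).range :=
  range_eq_of_mul h.inner rfl

theorem IsCoreInverse.ker_mul {A X : H →L[ℂ] H} (h : IsCoreInverse A X) :
    X.ker = (A * X).ker :=
  ker_eq_of_mul (u := X) (by rw [← mul_assoc, h.outer]) rfl

theorem IsCoreInverse.range_mul_self {A X : H →L[ℂ] H} (h : IsCoreInverse A X) :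
    A.range = (X * A).range := by
  obtain ⟨r, hr⟩ := h.exists_right_factor
  exact range_eq_of_mul h.mul_mul_self (v := r * A) (by rw [← mul_assoc, hr])

theorem IsCoreInverse.ker_mul_self {A X : H →L[ℂ] H} (h : IsCoreInverse A X) :
    A.ker = (X * A).ker :=
  ker_eq_of_mul (u := A) (by rw [← mul_assoc, h.inner]) rfl

theorem IsDualCoreInverse.range_eq {A X : H →L[ℂ] H} (h : IsDualCoreInverse A X) :
    X.range = (star A).range := by
  obtain ⟨r, hr⟩ : ∃ r, star A * r = X := h.right_ideal.subset ⟨1, mul_one X⟩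
  obtain ⟨t, ht⟩ : ∃ t, X * t = star A := h.right_ideal.superset ⟨1, mul_one _⟩
  exact range_eq_of_mul hr ht

theorem IsDualCoreInverse.ker_eq {A X : H →L[ℂ] H} (h : IsDualCoreInverse A X) :
    X.ker = A.ker := by
  obtain ⟨r, hr⟩ : ∃ r, r * A = X := h.left_ideal.subset ⟨1, one_mul X⟩
  obtain ⟨t, ht⟩ : ∃ t, t * X = A := h.left_ideal.superset ⟨1, one_mul _⟩
  exact ker_eq_of_mul hr ht

theorem IsDualCoreInverse.ker_mul {A X : H →L[ℂ] H} (h : IsDualCoreInverse A X) :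
    A.ker = (X * A).ker :=
  ker_eq_of_mul (u := A) (by rw [← mul_assoc, h.inner]) rfl

theorem IsDualCoreInverse.range_star {A X : H →L[ℂ] H} (h : IsDualCoreInverse A X) :
    (star A).range = (X * A).range := by
  rw [h.isCoreInverse_star.range_mul, ← star_mul, h.isStarProjection.isSelfAdjoint.star_eq]

/-- Completeness of `H` supplies the orthogonal projection along `A.ker`, which has the same kernel
as `X * A`. -/
theorem CoreInvertible.dualCoreInvertible {A : H →L[ℂ] H} (h : CoreInvertible A) :
    DualCoreInvertible A := by
  obtain ⟨X, hX⟩ := h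
  have hK : IsClosed (A.ker : Set H) := A.isClosed_ker
  have : CompleteSpace A.ker := hK.completeSpace_coe
  have hs : IsStarProjection (1 - A.ker.starProjection) :=
    (isStarProjection_starProjection (U := A.ker)).one_sub
  refine ⟨_, hX.isDualCoreInverse hs.isSelfAdjoint.star_eq ?_ ?_⟩
  · ext z
    have hz : A (A.ker.starProjection z) = 0 := Submodule.starProjection_apply_mem A.ker z
    simp [hz]
  -- `A * (X * A - 1) = 0`, so `X * A - 1` maps into `A.ker`, where the projection vanishes.
  · rw [← sub_eq_zero, ← mul_sub_one]
    ext z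
    have hz : A.ker.starProjection ((X * A - 1) z) = (X * A - 1) z := by
      rw [Submodule.starProjection_eq_self_iff]
      have h0 : A * (X * A - 1) = 0 := by rw [mul_sub, mul_one, ← mul_assoc, hX.inner, sub_self]
      exact congrArg (fun T : H →L[ℂ] H => T z) h0
    rw [mul_apply_eq_comp, sub_apply, hz]
    simp

theorem DualCoreInvertible.coreInvertible {A : H →L[ℂ] H} (h : DualCoreInvertible A) :
    CoreInvertible A := by
  obtain ⟨X, hX⟩ := h
  obtain ⟨Y, hY⟩ := CoreInvertible.dualCoreInvertible ⟨_, hX.isCoreInverse_star⟩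
  exact ⟨star Y, by simpa using hY.isCoreInverse_star⟩

theorem coreInvertible_and_dualCoreInvertible {A : H →L[ℂ] H}
    (h : CoreInvertible A ∨ DualCoreInvertible A) : CoreInvertible A ∧ DualCoreInvertible A :=
  h.elim (fun h => ⟨h, h.dualCoreInvertible⟩) fun h => ⟨h.coreInvertible, h⟩

theorem IsDualCoreInverse.tendsto_iff {ι : Type*} {l : Filter ι} {A X : H →L[ℂ] H}
    {B Y : ι → H →L[ℂ] H} (h : IsDualCoreInverse A X) (hB : ∀ i, IsDualCoreInverse (B i) (Y i))
    (hlim : Tendsto B l (𝓝 A)) :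
    Tendsto Y l (𝓝 X) ↔ Tendsto (fun i => Y i * B i) l (𝓝 (X * A)) := by
  have h1 := h.isCoreInverse_star.tendsto_iff (fun i => (hB i).isCoreInverse_star) hlim.star
  simp only [← star_mul, h.isStarProjection.isSelfAdjoint.star_eq,
    fun i => (hB i).isStarProjection.isSelfAdjoint.star_eq] at h1
  rw [← h1]
  exact ⟨fun h => h.star, fun h => by simpa using h.star⟩

end Hilbert

/-! ### The equivalences. -/

theorem theorem4p3 {H : Type*} [NormedAddCommGroup H] [InnerProductSpace ℂ H] [CompleteSpace H]
    (A : H →L[ℂ] H) (hA0 : A ≠ 0) (hA : CoreInvertible A ∨ DualCoreInvertible A)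
    (An : ℕ → H →L[ℂ] H) (hAn : ∀ n, CoreInvertible (An n) ∨ DualCoreInvertible (An n))
    (hlim : Tendsto An atTop (𝓝 A)) :
    (CoreInvertible A ∧ DualCoreInvertible A) ∧
    (∀ n, CoreInvertible (An n) ∧ DualCoreInvertible (An n)) ∧
    [ Tendsto (fun n => coreInverse (An n)) atTop (𝓝 (coreInverse A)),
      Tendsto (fun n => dualCoreInverse (An n)) atTop (𝓝 (dualCoreInverse A)),
      Tendsto (fun n => coreInverse (An n) * An n) atTop (𝓝 (coreInverse A * A)),
      Tendsto (fun n => An n * dualCoreInverse (An n)) atTop (𝓝 (coreInverse A * A)),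
      Tendsto (fun n => gap (coreInverse (An n)).range (coreInverse A).range) atTop (𝓝 0),
      Tendsto (fun n => gap (An n).range A.range) atTop (𝓝 0),
      Tendsto (fun n => gap (coreInverse (An n)).ker (coreInverse A).ker) atTop (𝓝 0),
      Tendsto (fun n => gap (ContinuousLinearMap.adjoint (An n)).ker
        (ContinuousLinearMap.adjoint A).ker) atTop (𝓝 0),
      Tendsto (fun n => gap (dualCoreInverse (An n)).range (dualCoreInverse A).range)
        atTop (𝓝 0),
      Tendsto (fun n => gap (ContinuousLinearMap.adjoint (An n)).range
        (ContinuousLinearMap.adjoint A).range) atTop (𝓝 0),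
      Tendsto (fun n => gap (dualCoreInverse (An n)).ker (dualCoreInverse A).ker) atTop (𝓝 0),
      Tendsto (fun n => gap (An n).ker A.ker) atTop (𝓝 0) ].TFAE := by
  have hC := coreInvertible_and_dualCoreInvertible hA
  have hCn := fun n => coreInvertible_and_dualCoreInvertible (hAn n)
  refine ⟨hC, hCn, ?_⟩
  have hx := hC.1.isCoreInverse
  have hy := hC.2.isDualCoreInverse
  have hxn := fun n => (hCn n).1.isCoreInverse
  have hyn := fun n => (hCn n).2.isDualCoreInverse
  have hg : IsIdempotentElem (coreInverse A * A) := by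
    rw [IsIdempotentElem, ← mul_assoc, hx.outer]
  have hgn : ∀ n, IsIdempotentElem (coreInverse (An n) * An n) := fun n => by
    rw [IsIdempotentElem, ← mul_assoc, (hxn n).outer]
  simp only [← ContinuousLinearMap.star_eq_adjoint]
  tfae_have 1 ↔ 6 := by
    simp only [hx.range_mul, fun n => (hxn n).range_mul]
    rw [hx.isStarProjection.tendsto_gap_range_iff fun n => (hxn n).isStarProjection]
    exact hx.tendsto_iff hxn hlim
  tfae_have 5 ↔ 6 := by simp only [hx.range_eq, fun n => (hxn n).range_eq]
  tfae_have 7 ↔ 8 := by simp only [hx.ker_eq, fun n => (hxn n).ker_eq]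
  tfae_have 1 ↔ 7 := by
    simp only [hx.ker_mul, fun n => (hxn n).ker_mul]
    rw [hx.isStarProjection.tendsto_gap_ker_iff fun n => (hxn n).isStarProjection]
    exact hx.tendsto_iff hxn hlim
  tfae_have 9 ↔ 10 := by simp only [hy.range_eq, fun n => (hyn n).range_eq]
  tfae_have 11 ↔ 12 := by simp only [hy.ker_eq, fun n => (hyn n).ker_eq]
  tfae_have 2 ↔ 12 := by
    simp only [hy.ker_mul, fun n => (hyn n).ker_mul]
    rw [hy.isStarProjection.tendsto_gap_ker_iff fun n => (hyn n).isStarProjection]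
    exact hy.tendsto_iff hyn hlim
  tfae_have 2 ↔ 10 := by
    simp only [hy.range_star, fun n => (hyn n).range_star]
    rw [hy.isStarProjection.tendsto_gap_range_iff fun n => (hyn n).isStarProjection]
    exact hy.tendsto_iff hyn hlim
  tfae_have 3 ↔ 4 := by simp only [fun n => (hxn n).mul_eq_mul_dual (hyn n)]
  tfae_have 1 → 3 := fun h => h.mul hlim
  tfae_have 2 → 4 := fun h => by
    rw [hx.mul_eq_mul_dual hy]
    exact hlim.mul h
  -- The oblique idempotent closes the cycle: its range gives the core statements here, and its
  -- kernel, the range of the complementary idempotent, gives the dual ones next.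
  tfae_have 3 → 6 := fun h => by
    simp only [hx.range_mul_self, fun n => (hxn n).range_mul_self]
    exact tendsto_gap_range hg hgn h
  tfae_have 3 → 12 := fun h => by
    simp only [hx.ker_mul_self, fun n => (hxn n).ker_mul_self, ker_eq_range_one_sub hg,
      fun n => ker_eq_range_one_sub (hgn n)]
    exact tendsto_gap_range hg.one_sub (fun n => (hgn n).one_sub) (h.const_sub 1)
  tfae_finish
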